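/- Let $d\in\mathbb{N}$. A quantum operation on $\mathcal{B}(\mathbb{C}^d)$ is a trace-preserving completely positive map $\mathcal{E}(\rho)=\sum_{i=1}^m E_i\rho E_i^\dagger$ with $\sum_i E_i^\dagger E_i=I$. For density operators put $\tilde F(\rho_0,\rho_1)=\max\{|\langle\psi_0|\psi_1\rangle| : \psi_k\in\mathrm{supp}(\rho_k),\ \|\psi_k\|=1\}$, where $\mathrm{supp}(\rho)$ is the span of the eigenvectors of $\rho$ with positive eigenvalue. For quantum operations $\mathcal{E}_0,\mathcal{E}_1$ put $$\tilde F_q(\mathcal{E}_0,\mathcal{E}_1)=\min\{\tilde F(\mathcal{E}_0(|\psi_0\rangle\langle\psi_0|),\mathcal{E}_1(|\psi_1\rangle\langle\psi_1|)) : \|\psi_0\|=\|\psi_1\|=1,\ \langle\psi_0|\psi_1\rangle=q\},$$ and $\tilde F^{ea}_q(\mathcal{E}_0,\mathcal{E}_1)=\tilde F_q(\mathcal{I}^R\otimes\mathcal{E}_0,\mathcal{I}^R\otimes\mathcal{E}_1)$, where $R$ is an auxiliary system of dimension $d$ and $\mathcal{I}$ denotes the identity operation. A general (entanglement-assisted)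 scheme with $n$ queries to an unknown operation $X$ on $\mathcal{B}(\mathbb{C}^d)$ prepares a state of $\mathbb{C}^{r_0}\otimes\mathbb{C}^d$ and then, for $k=0,\dots,n-1$, applies $\mathcal{I}\otimes X$ followed by a fixed quantum operation from $\mathcal{B}(\mathbb{C}^{r_k}\otimes\mathbb{C}^d)$ to $\mathcal{B}(\mathbb{C}^{r_{k+1}}\otimes\mathbb{C}^d)$; the auxiliary dimensions $r_k$ are arbitrary. Two operations are perfectly distinguishable with $n$ queries if, for some such scheme, some two-outcome measurement tells the two final states apart with certainty; they are perfectly distinguishable if this holds for some $n$, and then $N_{\min}$ is the least such $n$. Statement. Let $U$ be a unitary on $\mathbb{C}^d$ and $\mathcal{E}$ a quantum operation on $\mathcal{B}(\mathbb{C}^d)$, and let $\mathcal{E}'(\rho)=U^\dagger\mathcal{E}(\rho)U$ (so that $\mathcal{E}'=\mathcal{E}$ if $U=I$). If the operation $\rho\mapsto U\rho U^\dagger$ and $\mathcal{E}$ are perfectly distinguishable, then $\tilde F^{ea}_1(\mathcal{E}',\mathcal{I})<1$, and their optimal query number satisfies $$N_{\min}\ \ge\ \left\lceil\frac{\pi}{2\arccos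 \tilde F^{ea}_1(\mathcal{E}',\mathcal{I})}\right\rceil .$$ -/

import Mathlib

open scoped ComplexOrder Matrix

noncomputable section

namespace QDisc

/-- Linear maps `B(ℋ_ι) → B(ℋ_κ)`, operators being written as matrices in the standard bases. -/
abbrev SuperOp (ι κ : Type) : Type := Matrix ι ι ℂ →ₗ[ℂ] Matrix κ κ ℂ

/-- `ρ` is a density operator: positive, with trace one. -/
def IsDensity {ι : Type} [Fintype ι] (ρ : Matrix ι ι ℂ) : Prop :=
  ρ.PosSemidef ∧ ρ.trace = 1

/-- `Φ` is a quantum operation: `Φ(ρ) = ∑ᵢ Eᵢ ρ Eᵢ†` for finitely many Kraus operators `Eᵢ` with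
`∑ᵢ Eᵢ† Eᵢ = I` (in finite dimension, exactly the trace-preserving completely positive maps). -/
def IsQuantumOperation {ι κ : Type} [Fintype ι] [DecidableEq ι] [Fintype κ]
    (Φ : SuperOp ι κ) : Prop :=
  ∃ (m : ℕ) (E : Fin m → Matrix κ ι ℂ),
    (∑ i, (E i)ᴴ * E i = 1) ∧ ∀ ρ : Matrix ι ι ℂ, Φ ρ = ∑ i, E i * ρ * (E i)ᴴ

/-- The operation `ρ ↦ A ρ A†`. -/
def conjOp {ι : Type} [Fintype ι] (A : Matrix ι ι ℂ) : SuperOp ι ι where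
  toFun ρ := A * ρ * Aᴴ
  map_add' ρ σ := by rw [Matrix.mul_add, Matrix.add_mul]
  map_smul' c ρ := by simp

/-- `ℐ^R ⊗ Φ`: `Φ` applied to the second tensor factor, that is, to each of the blocks
`ρ_{rs}` of `ρ = ∑ |r⟩⟨s| ⊗ ρ_{rs}`. -/
def idTensor (R : Type) {ι κ : Type} (Φ : SuperOp ι κ) : SuperOp (R × ι) (R × κ) where
  toFun ρ := Matrix.of fun x y => Φ (Matrix.of fun i j => ρ (x.1, i) (y.1, j)) x.2 y.2
  map_add' ρ σ := by
    ext x y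
    exact congrFun (congrFun (Φ.map_add (Matrix.of fun i j => ρ (x.1, i) (y.1, j))
      (Matrix.of fun i j => σ (x.1, i) (y.1, j))) x.2) y.2
  map_smul' c ρ := by
    ext x y
    exact congrFun (congrFun (Φ.map_smul c (Matrix.of fun i j => ρ (x.1, i) (y.1, j))) x.2) y.2

/-- The density operator `|ψ⟩⟨ψ|` of a vector `ψ`. -/
def pureState {ι : Type} (ψ : EuclideanSpace ℂ ι) : Matrix ι ι ℂ :=
  Matrix.of fun i j => ψ i * star (ψ j)

/-- The support of a state: the range of `ρ`, which for a positive `ρ` is the span of its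
eigenvectors with positive eigenvalue. -/
def supp {ι : Type} [Fintype ι] [DecidableEq ι] (ρ : Matrix ι ι ℂ) :
    Submodule ℂ (EuclideanSpace ℂ ι) :=
  LinearMap.range (Matrix.toEuclideanLin ρ)

/-- The maximal fidelity of two states: the largest overlap of unit vectors in their supports. -/
def maxFidelity {ι : Type} [Fintype ι] [DecidableEq ι] (ρ₀ ρ₁ : Matrix ι ι ℂ) : ℝ :=
  sSup {x : ℝ | ∃ φ₀ ∈ supp ρ₀, ∃ φ₁ ∈ supp ρ₁,
    ‖φ₀‖ = 1 ∧ ‖φ₁‖ = 1 ∧ x = ‖inner ℂ φ₀ φ₁‖}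

/-- The `q`-maximal fidelity of two quantum operations: the least maximal fidelity of their outputs
on pure inputs with inner product `q`. -/
def qMaxFidelity {ι κ : Type} [Fintype ι] [Fintype κ] [DecidableEq κ]
    (q : ℝ) (Φ₀ Φ₁ : SuperOp ι κ) : ℝ :=
  sInf {x : ℝ | ∃ ψ₀ ψ₁ : EuclideanSpace ℂ ι, ‖ψ₀‖ = 1 ∧ ‖ψ₁‖ = 1 ∧
    inner ℂ ψ₀ ψ₁ = (q : ℂ) ∧ x = maxFidelity (Φ₀ (pureState ψ₀)) (Φ₁ (pureState ψ₁))}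

/-- The entanglement-assisted `q`-maximal fidelity; the auxiliary system has the dimension of the
input system. -/
def eaMaxFidelity {ι κ : Type} [Fintype ι] [Fintype κ] [DecidableEq ι] [DecidableEq κ]
    (q : ℝ) (Φ₀ Φ₁ : SuperOp ι κ) : ℝ :=
  qMaxFidelity q (idTensor ι Φ₀) (idTensor ι Φ₁)

/-- A general (adaptive, entanglement-assisted) scheme for querying an unknown operation on `ℋ_ι`.
An initial state, possibly mixed and entangled, of an auxiliary system and the queried system is
prepared; after the `k`-th query (`k = 0, 1, …`) a known quantum operation `op k` is applied
jointly to both systems, which may also change the dimension `aux k` of the auxiliary system. -/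
structure Scheme (ι : Type) [Fintype ι] [DecidableEq ι] where
  aux : ℕ → ℕ
  init : Matrix (Fin (aux 0) × ι) (Fin (aux 0) × ι) ℂ
  init_isDensity : IsDensity init
  op : ∀ k, SuperOp (Fin (aux k) × ι) (Fin (aux (k + 1)) × ι)
  op_isQuantumOperation : ∀ k, IsQuantumOperation (op k)

/-- The joint state after `n` queries to the operation `X` (and the known operations that follow
each of them). -/
def Scheme.state {ι : Type} [Fintype ι] [DecidableEq ι] (S : Scheme ι) (X : SuperOp ι ι) :
    ∀ n : ℕ, Matrix (Fin (S.aux n) × ι) (Fin (S.aux n) × ι) ℂ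
  | 0 => S.init
  | n + 1 => S.op n (idTensor (Fin (S.aux n)) X (S.state X n))

/-- Some two-outcome measurement `{M, 1 - M}` identifies with certainty which of the two states
`ρ₀`, `ρ₁` is present. -/
def PerfectlyDistinguishableStates {ι : Type} [Fintype ι] [DecidableEq ι]
    (ρ₀ ρ₁ : Matrix ι ι ℂ) : Prop :=
  ∃ M : Matrix ι ι ℂ, M.PosSemidef ∧ (1 - M).PosSemidef ∧
    (M * ρ₀).trace = 1 ∧ ((1 - M) * ρ₁).trace = 1

/-- Some general scheme identifies with certainty, by `n` queries, which of `X₀`, `X₁` is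
queried. -/
def DistinguishableIn {ι : Type} [Fintype ι] [DecidableEq ι] (n : ℕ) (X₀ X₁ : SuperOp ι ι) :
    Prop :=
  ∃ S : Scheme ι, PerfectlyDistinguishableStates (S.state X₀ n) (S.state X₁ n)

/-- Perfect distinguishability by finitely many queries. -/
def PerfectlyDistinguishable {ι : Type} [Fintype ι] [DecidableEq ι] (X₀ X₁ : SuperOp ι ι) :
    Prop :=
  ∃ n : ℕ, DistinguishableIn n X₀ X₁

/-- The optimal number of queries `N_min` (meaningful for perfectly distinguishable operations). -/
def minQueries {ι : Type} [Fintype ι] [DecidableEq ι] (X₀ X₁ : SuperOp ι ι) : ℕ :=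
  sInf {n : ℕ | DistinguishableIn n X₀ X₁}

end QDisc

end

/-! On unit vectors, `arccos |⟨a|b⟩|` satisfies the triangle inequality, so `arccos` of the maximal
fidelity measures how far apart two states are. Let `φ₀`, `φ₁` be unit vectors in the supports of
the current states for `ℰ` and for `U` that attain their maximal fidelity. The support of
`(ℐ ⊗ ℰ)(|φ₀⟩⟨φ₀|)` contains a unit vector whose angle with `(I ⊗ U)φ₀` is at most
`arccos F̃₁ᵉᵃ(ℰ', ℐ)`, and `I ⊗ U` preserves the angle between `φ₀` and `φ₁`. Hence one query
increases the distance by at most `arccos F̃₁ᵉᵃ(ℰ', ℐ)`, while known operations never increase it.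
The distance starts at `0` and is `π / 2` for perfectly distinguishable states.
-/

namespace QDisc

open scoped Kronecker
open Matrix (toEuclideanLin)

section InnerProductSpace

variable {𝕜 E : Type*} [RCLike 𝕜] [NormedAddCommGroup E] [InnerProductSpace 𝕜 E]

theorem arccos_norm_inner_le_add {a b c : E} (ha : ‖a‖ = 1) (hb : ‖b‖ = 1) (hc : ‖c‖ = 1) :
    Real.arccos ‖inner 𝕜 a c‖ ≤ Real.arccos ‖inner 𝕜 a b‖ + Real.arccos ‖inner 𝕜 b c‖ := by
  -- Rotating `a` and `c` by phases makes both overlaps with `b` real and nonnegative.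
  obtain ⟨u, hu, hua⟩ := RCLike.exists_norm_eq_mul_self (inner 𝕜 b a)
  obtain ⟨v, hv, hvc⟩ := RCLike.exists_norm_eq_mul_self (inner 𝕜 b c)
  let := InnerProductSpace.rclikeToReal 𝕜 E
  have angle_eq {x y : E} (hx : ‖x‖ = 1) (hy : ‖y‖ = 1) :
      InnerProductGeometry.angle x y = Real.arccos (RCLike.re (inner 𝕜 x y)) := by
    rw [InnerProductGeometry.angle, hx, hy, mul_one, div_one, real_inner_eq_re_inner 𝕜]
  have ha' : ‖u • a‖ = 1 := by rw [norm_smul, hu, ha, mul_one]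
  have hc' : ‖v • c‖ = 1 := by rw [norm_smul, hv, hc, mul_one]
  have hac : RCLike.re (inner 𝕜 (u • a) (v • c)) ≤ ‖inner 𝕜 a c‖ := by
    refine (RCLike.re_le_norm _).trans_eq ?_
    rw [inner_smul_left, inner_smul_right, norm_mul, norm_mul, RCLike.norm_conj, hu, hv, one_mul,
      one_mul]
  have hab : RCLike.re (inner 𝕜 (u • a) b) = ‖inner 𝕜 a b‖ := by
    rw [inner_re_symm, inner_smul_right, ← hua, RCLike.ofReal_re, norm_inner_symm]
  have hbc : RCLike.re (inner 𝕜 b (v • c)) = ‖inner 𝕜 b c‖ := by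
    rw [inner_smul_right, ← hvc, RCLike.ofReal_re]
  calc Real.arccos ‖inner 𝕜 a c‖
      ≤ Real.arccos (RCLike.re (inner 𝕜 (u • a) (v • c))) := Real.antitone_arccos hac
    _ ≤ Real.arccos ‖inner 𝕜 a b‖ + Real.arccos ‖inner 𝕜 b c‖ := by
      rw [← angle_eq ha' hc', ← hab, ← hbc, ← angle_eq ha' hb, ← angle_eq hb hc']
      exact InnerProductGeometry.angle_le_angle_add_angle _ _ _

theorem exists_sum_inner_smul_eq {ι : Type*} [Fintype ι] (W : Submodule 𝕜 E)
    [FiniteDimensional 𝕜 W] (hW : Module.finrank 𝕜 W ≤ Fintype.card ι) :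
    ∃ v : ι → E, ∀ x ∈ W, ∑ k, inner 𝕜 (v k) x • v k = x := by
  let b := stdOrthonormalBasis 𝕜 W
  obtain ⟨f⟩ : Nonempty (Fin (Module.finrank 𝕜 W) ↪ ι) :=
    Function.Embedding.nonempty_of_card_le (by simpa using hW)
  refine ⟨Function.extend f (fun k => (b k : E)) 0, fun x hx => ?_⟩
  calc ∑ k, inner 𝕜 (Function.extend f (fun k => (b k : E)) 0 k) x •
        Function.extend f (fun k => (b k : E)) 0 k
      = ∑ k, inner 𝕜 (b k : E) x • (b k : E) := by
        refine (Fintype.sum_of_injective f f.injective _ _ (fun i hi => ?_) fun k => ?_).symm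
        · simp [Function.extend_apply' _ _ _ hi]
        · simp [f.injective.extend_apply]
    _ = x := by
        simpa using congrArg Subtype.val (b.sum_repr' ⟨x, hx⟩)

theorem exists_mul_conjTranspose_mul_eq {m n : Type*} [Fintype m] [Fintype n] (M : Matrix m n 𝕜) :
    ∃ V : Matrix m n 𝕜, V * Vᴴ * M = M := by
  let col (j : n) : EuclideanSpace 𝕜 m := WithLp.toLp 2 fun i => M i j
  obtain ⟨v, hv⟩ := exists_sum_inner_smul_eq (Submodule.span 𝕜 (Set.range col))
    (finrank_range_le_card col)
  refine ⟨Matrix.of fun i k => v k i, ?_⟩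
  rw [Matrix.mul_assoc]
  ext i j
  have h := congrArg (fun x : EuclideanSpace 𝕜 m => x i)
    (hv (col j) (Submodule.subset_span ⟨j, rfl⟩))
  simpa [Matrix.mul_apply, col, PiLp.inner_apply, mul_comm] using h

end InnerProductSpace

section ToEuclideanLin

variable {𝕜 l m n : Type*} [RCLike 𝕜]

theorem toEuclideanLin_mul_apply [Fintype m] [DecidableEq m] [Fintype n] [DecidableEq n]
    (A : Matrix l m 𝕜) (B : Matrix m n 𝕜) (x : EuclideanSpace 𝕜 n) :
    toEuclideanLin (A * B) x = toEuclideanLin A (toEuclideanLin B x) :=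
  LinearMap.congr_fun (Matrix.toLpLin_mul 2 2 2 A B) x

theorem toEuclideanLin_one_apply [Fintype n] [DecidableEq n] (x : EuclideanSpace 𝕜 n) :
    toEuclideanLin (1 : Matrix n n 𝕜) x = x := by
  simp [Matrix.toEuclideanLin]

variable [Fintype m] [Fintype n] [DecidableEq n]

theorem inner_toEuclideanLin_left [DecidableEq m] (A : Matrix m n 𝕜) (x : EuclideanSpace 𝕜 n)
    (y : EuclideanSpace 𝕜 m) :
    inner 𝕜 (toEuclideanLin A x) y = inner 𝕜 x (toEuclideanLin Aᴴ y) := by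
  rw [Matrix.toEuclideanLin_conjTranspose_eq_adjoint, LinearMap.adjoint_inner_right]

theorem inner_toEuclideanLin_toEuclideanLin_of_fixed {A : Matrix m n 𝕜}
    {y : EuclideanSpace 𝕜 n} (hy : toEuclideanLin (Aᴴ * A) y = y) (x : EuclideanSpace 𝕜 n) :
    inner 𝕜 (toEuclideanLin A x) (toEuclideanLin A y) = inner 𝕜 x y := by
  classical rw [inner_toEuclideanLin_left, ← toEuclideanLin_mul_apply, hy]

theorem norm_toEuclideanLin_of_fixed {A : Matrix m n 𝕜} {x : EuclideanSpace 𝕜 n}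
    (hx : toEuclideanLin (Aᴴ * A) x = x) : ‖toEuclideanLin A x‖ = ‖x‖ := by
  rw [norm_eq_sqrt_re_inner (𝕜 := 𝕜), norm_eq_sqrt_re_inner (𝕜 := 𝕜) x,
    inner_toEuclideanLin_toEuclideanLin_of_fixed hx]

theorem range_toEuclideanLin_mul_conjTranspose [DecidableEq m] (A : Matrix m n 𝕜) :
    LinearMap.range (toEuclideanLin (A * Aᴴ)) = LinearMap.range (toEuclideanLin A) := by
  rw [← LinearMap.range_self_comp_adjoint (toEuclideanLin A),
    ← Matrix.toEuclideanLin_conjTranspose_eq_adjoint]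
  exact congrArg LinearMap.range (LinearMap.ext (toEuclideanLin_mul_apply A Aᴴ))

theorem inner_toEuclideanLin_self_eq_zero_iff {A : Matrix n n 𝕜} (hA : A.PosSemidef)
    {x : EuclideanSpace 𝕜 n} :
    inner 𝕜 x (toEuclideanLin A x) = 0 ↔ toEuclideanLin A x = 0 := by
  rw [EuclideanSpace.inner_eq_star_dotProduct, dotProduct_comm, ← WithLp.ofLp_eq_zero 2,
    Matrix.ofLp_toLpLin, Matrix.toLin'_apply, hA.dotProduct_mulVec_zero_iff]

theorem ker_toEuclideanLin_sum {ι : Type*} [Fintype ι] {A : ι → Matrix n n 𝕜}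
    (hA : ∀ i, (A i).PosSemidef) :
    LinearMap.ker (toEuclideanLin (∑ i, A i)) = ⨅ i, LinearMap.ker (toEuclideanLin (A i)) := by
  ext x
  simp only [Submodule.mem_iInf, LinearMap.mem_ker]
  rw [← inner_toEuclideanLin_self_eq_zero_iff (Matrix.posSemidef_sum _ fun i _ => hA i), map_sum,
    LinearMap.sum_apply, inner_sum, Finset.sum_eq_zero_iff_of_nonneg fun i _ =>
      (Matrix.isPositive_toEuclideanLin_iff.2 (hA i)).inner_nonneg_right x]
  simp only [Finset.mem_univ, forall_const, inner_toEuclideanLin_self_eq_zero_iff (hA _)]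

theorem range_toEuclideanLin_sum {ι : Type*} [Fintype ι] {A : ι → Matrix n n 𝕜}
    (hA : ∀ i, (A i).PosSemidef) :
    LinearMap.range (toEuclideanLin (∑ i, A i)) =
      ⨆ i, LinearMap.range (toEuclideanLin (A i)) := by
  have orthogonal_range {B : Matrix n n 𝕜} (hB : B.PosSemidef) :
      (LinearMap.range (toEuclideanLin B))ᗮ = LinearMap.ker (toEuclideanLin B) :=
    (Matrix.isSymmetric_toEuclideanLin_iff.2 hB.1).orthogonal_range
  suffices (LinearMap.range (toEuclideanLin (∑ i, A i)))ᗮ =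
      (⨆ i, LinearMap.range (toEuclideanLin (A i)))ᗮ by
    simpa only [Submodule.orthogonal_orthogonal] using congrArg Submodule.orthogonal this
  simp only [orthogonal_range (Matrix.posSemidef_sum _ fun i _ => hA i), ker_toEuclideanLin_sum hA,
    ← Submodule.iInf_orthogonal, orthogonal_range (hA _)]

theorem sum_inner_toEuclideanLin {ι : Type*} [Fintype ι]
    {K : ι → Matrix m n 𝕜} (hK : ∑ i, (K i)ᴴ * K i = 1) (x y : EuclideanSpace 𝕜 n) :
    ∑ i, inner 𝕜 (toEuclideanLin (K i) x) (toEuclideanLin (K i) y) = inner 𝕜 x y := by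
  classical
  simp_rw [inner_toEuclideanLin_left, ← toEuclideanLin_mul_apply]
  rw [← inner_sum, ← LinearMap.sum_apply, ← map_sum, hK, toEuclideanLin_one_apply]

theorem sum_norm_sq_toEuclideanLin {ι : Type*} [Fintype ι]
    {K : ι → Matrix m n 𝕜} (hK : ∑ i, (K i)ᴴ * K i = 1) (x : EuclideanSpace 𝕜 n) :
    ∑ i, ‖toEuclideanLin (K i) x‖ ^ 2 = ‖x‖ ^ 2 := by
  simp only [← inner_self_eq_norm_sq (𝕜 := 𝕜), ← map_sum, sum_inner_toEuclideanLin hK]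

end ToEuclideanLin

section PosSemidef

variable {𝕜 n : Type*} [RCLike 𝕜] [Fintype n]

open scoped MatrixOrder in
theorem exists_eq_mul_conjTranspose_of_posSemidef {A : Matrix n n 𝕜} (hA : A.PosSemidef) :
    ∃ B : Matrix n n 𝕜, A = B * Bᴴ := by
  classical
  exact CStarAlgebra.nonneg_iff_eq_mul_star_self.1 hA.nonneg

theorem mul_eq_zero_of_trace_mul_eq_zero {A B : Matrix n n 𝕜} (hA : A.PosSemidef)
    (hB : B.PosSemidef) (h : (A * B).trace = 0) : A * B = 0 := by
  obtain ⟨S, rfl⟩ := exists_eq_mul_conjTranspose_of_posSemidef hA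
  obtain ⟨T, rfl⟩ := exists_eq_mul_conjTranspose_of_posSemidef hB
  have hST : Sᴴ * T = 0 := by
    rw [← Matrix.trace_conjTranspose_mul_self_eq_zero_iff, ← h, Matrix.conjTranspose_mul,
      Matrix.conjTranspose_conjTranspose, Matrix.mul_assoc, Matrix.trace_mul_comm]
    simp only [Matrix.mul_assoc]
  rw [Matrix.mul_assoc, ← Matrix.mul_assoc Sᴴ, hST, Matrix.zero_mul, Matrix.mul_zero]

end PosSemidef

section Support

variable {ι κ σ : Type}

theorem pureState_eq_vecMulVec (ψ : EuclideanSpace ℂ ι) :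
    pureState ψ = Matrix.vecMulVec ψ.ofLp (star ψ.ofLp) := rfl

variable [Fintype ι]

theorem isDensity_pureState {ψ : EuclideanSpace ℂ ι} (hψ : ‖ψ‖ = 1) : IsDensity (pureState ψ) := by
  refine ⟨Matrix.posSemidef_vecMulVec_self_star _, ?_⟩
  rw [pureState_eq_vecMulVec, Matrix.trace_vecMulVec, ← EuclideanSpace.inner_eq_star_dotProduct,
    inner_self_eq_norm_sq_to_K, hψ]
  simp

theorem IsDensity.ne_zero {ρ : Matrix ι ι ℂ} (hρ : IsDensity ρ) : ρ ≠ 0 := by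
  rintro rfl
  simpa using hρ.2

variable [DecidableEq ι]

theorem mul_pureState_mul_conjTranspose (A : Matrix κ ι ℂ) (ψ : EuclideanSpace ℂ ι) :
    A * pureState ψ * Aᴴ = pureState (toEuclideanLin A ψ) := by
  rw [pureState_eq_vecMulVec, pureState_eq_vecMulVec, Matrix.mul_vecMulVec, Matrix.vecMulVec_mul,
    Matrix.ofLp_toLpLin, Matrix.toLin'_apply, Matrix.star_mulVec]

theorem toEuclideanLin_pureState_apply (ψ x : EuclideanSpace ℂ ι) :
    toEuclideanLin (pureState ψ) x = inner ℂ ψ x • ψ := by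
  rw [pureState_eq_vecMulVec, ← InnerProductSpace.symm_toEuclideanLin_rankOne,
    LinearEquiv.apply_symm_apply]
  exact InnerProductSpace.rankOne_apply ψ ψ x

theorem supp_pureState (ψ : EuclideanSpace ℂ ι) : supp (pureState ψ) = ℂ ∙ ψ := by
  apply le_antisymm
  · rintro _ ⟨x, rfl⟩
    rw [toEuclideanLin_pureState_apply]
    exact Submodule.smul_mem _ _ (Submodule.mem_span_singleton_self ψ)
  · rw [Submodule.span_singleton_le_iff_mem]
    rcases eq_or_ne ψ 0 with rfl | hψ
    · exact zero_mem _
    · refine ⟨(inner ℂ ψ ψ)⁻¹ • ψ, ?_⟩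
      rw [toEuclideanLin_pureState_apply, inner_smul_right,
        inv_mul_cancel₀ (inner_self_ne_zero.2 hψ), one_smul]

theorem supp_ne_bot {ρ : Matrix ι ι ℂ} (hρ : ρ ≠ 0) : supp ρ ≠ ⊥ := by
  simpa [supp, LinearMap.range_eq_bot] using hρ

theorem exists_mem_supp_norm_eq_one {ρ : Matrix ι ι ℂ} (hρ : ρ ≠ 0) : ∃ φ ∈ supp ρ, ‖φ‖ = 1 := by
  obtain ⟨φ, hφ, hφ0⟩ := Submodule.exists_mem_ne_zero_of_ne_bot (supp_ne_bot hρ)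
  exact ⟨_, (supp ρ).smul_mem _ hφ, norm_smul_inv_norm (𝕜 := ℂ) hφ0⟩

variable [Fintype κ] [DecidableEq κ] [Fintype σ]

theorem supp_mul_mul_conjTranspose_le (A : Matrix κ ι ℂ) (ρ : Matrix ι ι ℂ) :
    supp (A * ρ * Aᴴ) ≤ (supp ρ).map (toEuclideanLin A) := by
  rintro _ ⟨x, rfl⟩
  rw [Matrix.mul_assoc, toEuclideanLin_mul_apply, toEuclideanLin_mul_apply]
  exact Submodule.mem_map_of_mem (LinearMap.mem_range_self _ _)

theorem supp_mul_mul_conjTranspose (A : Matrix κ ι ℂ) {ρ : Matrix ι ι ℂ} (hρ : ρ.PosSemidef) :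
    supp (A * ρ * Aᴴ) = (supp ρ).map (toEuclideanLin A) := by
  obtain ⟨B, rfl⟩ := exists_eq_mul_conjTranspose_of_posSemidef hρ
  have hAB : A * (B * Bᴴ) * Aᴴ = A * B * (A * B)ᴴ := by
    simp only [Matrix.conjTranspose_mul, Matrix.mul_assoc]
  rw [hAB, supp, supp, range_toEuclideanLin_mul_conjTranspose,
    range_toEuclideanLin_mul_conjTranspose, ← LinearMap.range_comp]
  exact congrArg LinearMap.range (LinearMap.ext (toEuclideanLin_mul_apply A B))

theorem supp_sum_mul_mul_conjTranspose (K : σ → Matrix κ ι ℂ) {ρ : Matrix ι ι ℂ}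
    (hρ : ρ.PosSemidef) :
    supp (∑ i, K i * ρ * (K i)ᴴ) = ⨆ i, (supp ρ).map (toEuclideanLin (K i)) := by
  simp only [← supp_mul_mul_conjTranspose _ hρ]
  exact range_toEuclideanLin_sum fun i => hρ.mul_mul_conjTranspose_same (K i)

end Support

section MaxFidelity

variable {ι κ : Type} [Fintype ι] [DecidableEq ι] [Fintype κ] [DecidableEq κ]

theorem maxFidelity_nonneg (ρ₀ ρ₁ : Matrix ι ι ℂ) : 0 ≤ maxFidelity ρ₀ ρ₁ := by
  refine Real.sSup_nonneg ?_
  rintro _ ⟨_, _, _, _, _, _, rfl⟩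
  exact norm_nonneg _

theorem maxFidelity_le {ρ₀ ρ₁ : Matrix ι ι ℂ} {c : ℝ} (hc : 0 ≤ c)
    (h : ∀ φ₀ ∈ supp ρ₀, ∀ φ₁ ∈ supp ρ₁, ‖φ₀‖ = 1 → ‖φ₁‖ = 1 → ‖inner ℂ φ₀ φ₁‖ ≤ c) :
    maxFidelity ρ₀ ρ₁ ≤ c := by
  refine Real.sSup_le ?_ hc
  rintro _ ⟨φ₀, h₀, φ₁, h₁, n₀, n₁, rfl⟩
  exact h φ₀ h₀ φ₁ h₁ n₀ n₁

theorem norm_inner_le_maxFidelity {ρ₀ ρ₁ : Matrix ι ι ℂ} {φ₀ φ₁ : EuclideanSpace ℂ ι}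
    (h₀ : φ₀ ∈ supp ρ₀) (h₁ : φ₁ ∈ supp ρ₁) (n₀ : ‖φ₀‖ = 1) (n₁ : ‖φ₁‖ = 1) :
    ‖inner ℂ φ₀ φ₁‖ ≤ maxFidelity ρ₀ ρ₁ := by
  refine le_csSup ⟨1, ?_⟩ ⟨φ₀, h₀, φ₁, h₁, n₀, n₁, rfl⟩
  rintro _ ⟨a, -, b, -, ha, hb, rfl⟩
  simpa [ha, hb] using norm_inner_le_norm (𝕜 := ℂ) a b

theorem norm_inner_le_maxFidelity_mul {ρ₀ ρ₁ : Matrix ι ι ℂ} {φ₀ φ₁ : EuclideanSpace ℂ ι}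
    (h₀ : φ₀ ∈ supp ρ₀) (h₁ : φ₁ ∈ supp ρ₁) :
    ‖inner ℂ φ₀ φ₁‖ ≤ maxFidelity ρ₀ ρ₁ * (‖φ₀‖ * ‖φ₁‖) := by
  rcases eq_or_ne φ₀ 0 with rfl | hφ₀
  · simp
  rcases eq_or_ne φ₁ 0 with rfl | hφ₁
  · simp
  have h := norm_inner_le_maxFidelity ((supp ρ₀).smul_mem _ h₀) ((supp ρ₁).smul_mem _ h₁)
    (norm_smul_inv_norm (𝕜 := ℂ) hφ₀) (norm_smul_inv_norm (𝕜 := ℂ) hφ₁)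
  rw [inner_smul_left, inner_smul_right, norm_mul, norm_mul, RCLike.norm_conj, norm_inv, norm_inv,
    RCLike.norm_ofReal, RCLike.norm_ofReal, abs_norm, abs_norm, ← mul_assoc, ← mul_inv,
    inv_mul_le_iff₀ (by positivity)] at h
  rwa [mul_comm]

theorem exists_norm_inner_eq_maxFidelity {ρ₀ ρ₁ : Matrix ι ι ℂ} (h₀ : ρ₀ ≠ 0) (h₁ : ρ₁ ≠ 0) :
    ∃ φ₀ ∈ supp ρ₀, ∃ φ₁ ∈ supp ρ₁, ‖φ₀‖ = 1 ∧ ‖φ₁‖ = 1 ∧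
      ‖inner ℂ φ₀ φ₁‖ = maxFidelity ρ₀ ρ₁ := by
  have isCompact_unitVectors (ρ : Matrix ι ι ℂ) :
      IsCompact {φ : EuclideanSpace ℂ ι | φ ∈ supp ρ ∧ ‖φ‖ = 1} := by
    simpa only [← mem_sphere_zero_iff_norm] using!
      (isCompact_sphere 0 1).inter_left (supp ρ).closed_of_finiteDimensional
  obtain ⟨a, ha⟩ := exists_mem_supp_norm_eq_one h₀
  obtain ⟨b, hb⟩ := exists_mem_supp_norm_eq_one h₁
  obtain ⟨⟨φ₀, φ₁⟩, ⟨hφ₀, hφ₁⟩, hmax⟩ :=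
    ((isCompact_unitVectors ρ₀).prod (isCompact_unitVectors ρ₁)).exists_isMaxOn
      ⟨(a, b), ha, hb⟩ (f := fun p => ‖inner ℂ p.1 p.2‖) (by fun_prop)
  refine ⟨φ₀, hφ₀.1, φ₁, hφ₁.1, hφ₀.2, hφ₁.2, le_antisymm ?_ ?_⟩
  · exact norm_inner_le_maxFidelity hφ₀.1 hφ₁.1 hφ₀.2 hφ₁.2
  · exact maxFidelity_le (norm_nonneg _) fun a ha b hb na nb =>
      hmax (a := (a, b)) ⟨⟨ha, na⟩, hb, nb⟩

theorem exists_norm_inner_eq_maxFidelity_pureState {ρ : Matrix ι ι ℂ} (hρ : ρ ≠ 0)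
    {ψ : EuclideanSpace ℂ ι} (hψ : ‖ψ‖ = 1) :
    ∃ φ ∈ supp ρ, ‖φ‖ = 1 ∧ ‖inner ℂ φ ψ‖ = maxFidelity ρ (pureState ψ) := by
  obtain ⟨φ, hφ, χ, hχ, nφ, nχ, h⟩ :=
    exists_norm_inner_eq_maxFidelity hρ (isDensity_pureState hψ).ne_zero
  rw [supp_pureState, Submodule.mem_span_singleton] at hχ
  obtain ⟨c, rfl⟩ := hχ
  have hc : ‖c‖ = 1 := by rwa [norm_smul, hψ, mul_one] at nχ
  exact ⟨φ, hφ, nφ, by rw [← h, inner_smul_right, norm_mul, hc, one_mul]⟩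

theorem one_le_maxFidelity_self {ρ : Matrix ι ι ℂ} (hρ : ρ ≠ 0) : 1 ≤ maxFidelity ρ ρ := by
  obtain ⟨φ, hφ, nφ⟩ := exists_mem_supp_norm_eq_one hρ
  simpa [nφ] using norm_inner_le_maxFidelity hφ hφ nφ nφ

theorem maxFidelity_mul_mul_conjTranspose_le {A : Matrix κ ι ℂ} {ρ₀ ρ₁ : Matrix ι ι ℂ}
    (h₀ : Aᴴ * A * ρ₀ = ρ₀) (h₁ : Aᴴ * A * ρ₁ = ρ₁) :
    maxFidelity (A * ρ₀ * Aᴴ) (A * ρ₁ * Aᴴ) ≤ maxFidelity ρ₀ ρ₁ := by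
  have fixed {ρ : Matrix ι ι ℂ} (h : Aᴴ * A * ρ = ρ) {φ : EuclideanSpace ℂ ι}
      (hφ : φ ∈ supp ρ) : toEuclideanLin (Aᴴ * A) φ = φ := by
    obtain ⟨x, rfl⟩ := hφ
    rw [← toEuclideanLin_mul_apply, h]
  refine maxFidelity_le (maxFidelity_nonneg _ _) fun φ₀ hφ₀ φ₁ hφ₁ n₀ n₁ => ?_
  obtain ⟨χ₀, hχ₀, rfl⟩ := supp_mul_mul_conjTranspose_le A ρ₀ hφ₀
  obtain ⟨χ₁, hχ₁, rfl⟩ := supp_mul_mul_conjTranspose_le A ρ₁ hφ₁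
  rw [norm_toEuclideanLin_of_fixed (fixed h₀ hχ₀)] at n₀
  rw [norm_toEuclideanLin_of_fixed (fixed h₁ hχ₁)] at n₁
  rw [inner_toEuclideanLin_toEuclideanLin_of_fixed (fixed h₁ hχ₁)]
  exact norm_inner_le_maxFidelity hχ₀ hχ₁ n₀ n₁

theorem PerfectlyDistinguishableStates.symm {ρ₀ ρ₁ : Matrix ι ι ℂ}
    (h : PerfectlyDistinguishableStates ρ₀ ρ₁) : PerfectlyDistinguishableStates ρ₁ ρ₀ := by
  obtain ⟨M, hM, hM', hM₀, hM₁⟩ := h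
  exact ⟨1 - M, hM', by rwa [sub_sub_cancel], hM₁, by rwa [sub_sub_cancel]⟩

theorem PerfectlyDistinguishableStates.maxFidelity_eq_zero {ρ₀ ρ₁ : Matrix ι ι ℂ}
    (h : PerfectlyDistinguishableStates ρ₀ ρ₁) (h₀ : IsDensity ρ₀) (h₁ : IsDensity ρ₁) :
    maxFidelity ρ₀ ρ₁ = 0 := by
  obtain ⟨M, hM, hM', hM₀, hM₁⟩ := h
  have e₀ : M * ρ₀ = ρ₀ := by
    have h := mul_eq_zero_of_trace_mul_eq_zero hM' h₀.1 <| by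
      rw [Matrix.sub_mul, Matrix.one_mul, Matrix.trace_sub, hM₀, h₀.2, sub_self]
    rwa [Matrix.sub_mul, Matrix.one_mul, sub_eq_zero, eq_comm] at h
  have e₁ : M * ρ₁ = 0 := by
    apply mul_eq_zero_of_trace_mul_eq_zero hM h₁.1
    rw [Matrix.sub_mul, Matrix.one_mul, Matrix.trace_sub, h₁.2] at hM₁
    simpa using hM₁
  refine le_antisymm (maxFidelity_le le_rfl ?_) (maxFidelity_nonneg _ _)
  rintro _ ⟨x, rfl⟩ _ ⟨y, rfl⟩ - -
  rw [← e₀, toEuclideanLin_mul_apply, inner_toEuclideanLin_left, hM.1.eq,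
    ← toEuclideanLin_mul_apply, e₁, map_zero, LinearMap.zero_apply, inner_zero_right, norm_zero]

end MaxFidelity

section QuantumOperation

variable {ι κ : Type} [Fintype ι] [Fintype κ]

theorem conjOp_apply (A ρ : Matrix ι ι ℂ) : conjOp A ρ = A * ρ * Aᴴ := rfl

variable [DecidableEq ι]

theorem IsQuantumOperation.isDensity {Φ : SuperOp ι κ} (hΦ : IsQuantumOperation Φ)
    {ρ : Matrix ι ι ℂ} (hρ : IsDensity ρ) : IsDensity (Φ ρ) := by
  obtain ⟨m, K, hK, hΦ⟩ := hΦ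
  rw [hΦ]
  refine ⟨Matrix.posSemidef_sum _ fun i _ => hρ.1.mul_mul_conjTranspose_same (K i), ?_⟩
  calc (∑ i, K i * ρ * (K i)ᴴ).trace = ((∑ i, (K i)ᴴ * K i) * ρ).trace := by
        simp only [Matrix.trace_sum, Matrix.trace_mul_cycle (K _), Finset.sum_mul]
    _ = 1 := by rw [hK, Matrix.one_mul, hρ.2]

theorem isQuantumOperation_conjOp {U : Matrix ι ι ℂ} (hU : U ∈ Matrix.unitaryGroup ι ℂ) :
    IsQuantumOperation (conjOp U) :=
  ⟨1, fun _ => U, by simpa [Matrix.star_eq_conjTranspose] using Matrix.mem_unitaryGroup_iff'.1 hU,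
    fun ρ => by simp [conjOp_apply]⟩

variable [DecidableEq κ]

theorem IsQuantumOperation.supp_mono {Φ : SuperOp ι κ} (hΦ : IsQuantumOperation Φ)
    {ρ σ : Matrix ι ι ℂ} (hρ : ρ.PosSemidef) (hσ : σ.PosSemidef) (h : supp ρ ≤ supp σ) :
    supp (Φ ρ) ≤ supp (Φ σ) := by
  obtain ⟨m, K, -, hΦ⟩ := hΦ
  rw [hΦ, hΦ, supp_sum_mul_mul_conjTranspose K hρ, supp_sum_mul_mul_conjTranspose K hσ]
  exact iSup_mono fun i => Submodule.map_mono h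

theorem IsQuantumOperation.maxFidelity_le {Φ : SuperOp ι κ} (hΦ : IsQuantumOperation Φ)
    {ρ₀ ρ₁ : Matrix ι ι ℂ} (h₀ : ρ₀.PosSemidef) (h₁ : ρ₁.PosSemidef) :
    maxFidelity ρ₀ ρ₁ ≤ maxFidelity (Φ ρ₀) (Φ ρ₁) := by
  obtain ⟨m, K, hK, hΦ⟩ := hΦ
  have mem_supp {ρ : Matrix ι ι ℂ} (hρ : ρ.PosSemidef) {φ : EuclideanSpace ℂ ι} (hφ : φ ∈ supp ρ)
      (i : Fin m) : toEuclideanLin (K i) φ ∈ supp (Φ ρ) := by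
    rw [hΦ, supp_sum_mul_mul_conjTranspose K hρ]
    exact Submodule.mem_iSup_of_mem i (Submodule.mem_map_of_mem hφ)
  set F := maxFidelity (Φ ρ₀) (Φ ρ₁)
  have hF : 0 ≤ F := maxFidelity_nonneg _ _
  refine QDisc.maxFidelity_le hF fun a ha b hb na nb => ?_
  have sum_sq {x : EuclideanSpace ℂ ι} (hx : ‖x‖ = 1) : ∑ i, ‖toEuclideanLin (K i) x‖ ^ 2 = 1 := by
    rw [sum_norm_sq_toEuclideanLin hK, hx, one_pow]
  have cauchy_schwarz : ∑ i, ‖toEuclideanLin (K i) a‖ * ‖toEuclideanLin (K i) b‖ ≤ 1 := by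
    simpa only [sum_sq na, sum_sq nb, Real.sqrt_one, mul_one] using
      Real.sum_mul_le_sqrt_mul_sqrt Finset.univ (fun i => ‖toEuclideanLin (K i) a‖)
        fun i => ‖toEuclideanLin (K i) b‖
  calc ‖inner ℂ a b‖ = ‖∑ i, inner ℂ (toEuclideanLin (K i) a) (toEuclideanLin (K i) b)‖ := by
        rw [sum_inner_toEuclideanLin hK]
    _ ≤ ∑ i, F * (‖toEuclideanLin (K i) a‖ * ‖toEuclideanLin (K i) b‖) :=
        norm_sum_le_of_le _ fun i _ =>
          norm_inner_le_maxFidelity_mul (mem_supp h₀ ha i) (mem_supp h₁ hb i)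
    _ ≤ F := by
        rw [← Finset.mul_sum]
        exact mul_le_of_le_one_right hF cauchy_schwarz

end QuantumOperation

section IdTensor

variable {ι κ R : Type} [Fintype ι] [Fintype R]

theorem idTensor_mul_mul_kronecker_one {S : Type} [DecidableEq ι] [Fintype κ] [DecidableEq κ]
    (Φ : SuperOp ι κ) (A : Matrix S R ℂ) (ρ : Matrix (R × ι) (R × ι) ℂ)
    (B : Matrix R S ℂ) :
    idTensor S Φ ((A ⊗ₖ (1 : Matrix ι ι ℂ)) * ρ * (B ⊗ₖ (1 : Matrix ι ι ℂ))) =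
      (A ⊗ₖ (1 : Matrix κ κ ℂ)) * idTensor R Φ ρ * (B ⊗ₖ (1 : Matrix κ κ ℂ)) := by
  ext ⟨s, x⟩ ⟨t, y⟩
  have block : (Matrix.of fun i j =>
      ((A ⊗ₖ (1 : Matrix ι ι ℂ)) * ρ * (B ⊗ₖ (1 : Matrix ι ι ℂ))) (s, i) (t, j)) =
      ∑ q, ∑ r, (A s r * B q t) • Matrix.of fun i j => ρ (r, i) (q, j) := by
    ext i j
    simp [Matrix.mul_apply, Fintype.sum_prod_type, Matrix.one_apply, Matrix.sum_apply,
      Finset.sum_mul, mul_right_comm]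
  simp only [idTensor, LinearMap.coe_mk, AddHom.coe_mk, Matrix.of_apply]
  rw [block]
  simp [-Matrix.smul_of, Matrix.mul_apply, Fintype.sum_prod_type, Matrix.one_apply,
    Matrix.sum_apply, Finset.sum_mul, mul_right_comm]

variable [DecidableEq R]

theorem idTensor_eq_sum_mul_mul {σ : Type} [Fintype σ] {Φ : SuperOp ι κ}
    {A : σ → Matrix κ ι ℂ} {B : σ → Matrix ι κ ℂ} (hΦ : ∀ ρ, Φ ρ = ∑ i, A i * ρ * B i)
    (ρ : Matrix (R × ι) (R × ι) ℂ) :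
    idTensor R Φ ρ = ∑ i, ((1 : Matrix R R ℂ) ⊗ₖ A i) * ρ * ((1 : Matrix R R ℂ) ⊗ₖ B i) := by
  ext ⟨r, x⟩ ⟨s, y⟩
  simp only [idTensor, LinearMap.coe_mk, AddHom.coe_mk, Matrix.of_apply, hΦ, Matrix.sum_apply]
  refine Finset.sum_congr rfl fun i _ => ?_
  simp [Matrix.mul_apply, Fintype.sum_prod_type, Matrix.one_apply, Finset.sum_ite_irrel]

theorem idTensor_conjOp (A : Matrix ι ι ℂ) (ρ : Matrix (R × ι) (R × ι) ℂ) :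
    idTensor R (conjOp A) ρ = conjOp ((1 : Matrix R R ℂ) ⊗ₖ A) ρ := by
  have h := idTensor_eq_sum_mul_mul (R := R) (σ := Unit) (Φ := conjOp A) (A := fun _ => A)
    (B := fun _ => Aᴴ) (fun ρ => by simp [conjOp_apply]) ρ
  simpa [conjOp_apply, Matrix.conjTranspose_kronecker] using h

theorem idTensor_conjOp_pureState [DecidableEq ι] (A : Matrix ι ι ℂ)
    (ψ : EuclideanSpace ℂ (R × ι)) :
    idTensor R (conjOp A) (pureState ψ) =
      pureState (toEuclideanLin ((1 : Matrix R R ℂ) ⊗ₖ A) ψ) := by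
  rw [idTensor_conjOp, conjOp_apply, mul_pureState_mul_conjTranspose]

theorem IsQuantumOperation.idTensor [DecidableEq ι] [Fintype κ] {Φ : SuperOp ι κ}
    (hΦ : IsQuantumOperation Φ) : IsQuantumOperation (idTensor R Φ) := by
  obtain ⟨m, K, hK, hΦ⟩ := hΦ
  refine ⟨m, fun i => (1 : Matrix R R ℂ) ⊗ₖ K i, ?_, fun ρ => ?_⟩
  · calc ∑ i, ((1 : Matrix R R ℂ) ⊗ₖ K i)ᴴ * ((1 : Matrix R R ℂ) ⊗ₖ K i)
        = (1 : Matrix R R ℂ) ⊗ₖ ∑ i, (K i)ᴴ * K i := by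
          simp only [Matrix.conjTranspose_kronecker, ← Matrix.mul_kronecker_mul,
            Matrix.conjTranspose_one, Matrix.one_mul]
          exact (map_sum (Matrix.kroneckerBilinear (R := ℂ) (1 : Matrix R R ℂ)) _ _).symm
      _ = 1 := by rw [hK, Matrix.one_kronecker_one]
  · simpa only [Matrix.conjTranspose_kronecker, Matrix.conjTranspose_one] using
      idTensor_eq_sum_mul_mul hΦ ρ

end IdTensor

section AuxiliaryReduction

variable {ι κ R : Type} [Fintype ι] [Fintype R]

theorem qMaxFidelity_one_le [Fintype κ] [DecidableEq κ] (Φ₀ Φ₁ : SuperOp ι κ)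
    {ψ : EuclideanSpace ℂ ι} (hψ : ‖ψ‖ = 1) :
    qMaxFidelity 1 Φ₀ Φ₁ ≤ maxFidelity (Φ₀ (pureState ψ)) (Φ₁ (pureState ψ)) := by
  refine csInf_le ⟨0, ?_⟩ ⟨ψ, ψ, hψ, hψ, ?_, rfl⟩
  · rintro _ ⟨_, _, _, _, _, rfl⟩
    exact maxFidelity_nonneg _ _
  · simp [inner_self_eq_norm_sq_to_K, hψ]

variable [DecidableEq ι]

theorem exists_toEuclideanLin_kronecker_one_eq [DecidableEq R] (ψ : EuclideanSpace ℂ (R × ι)) :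
    ∃ V : Matrix R ι ℂ, toEuclideanLin ((V * Vᴴ) ⊗ₖ (1 : Matrix ι ι ℂ)) ψ = ψ := by
  obtain ⟨V, hV⟩ := exists_mul_conjTranspose_mul_eq (Matrix.of fun r i => ψ (r, i))
  refine ⟨V, ?_⟩
  ext ⟨r, i⟩
  have h := congrFun₂ hV r i
  rw [Matrix.mul_apply] at h
  simpa [Matrix.mulVec, dotProduct, Fintype.sum_prod_type, Matrix.one_apply] using h

variable [Fintype κ] [DecidableEq κ] [DecidableEq R]

-- By the Schmidt decomposition, a pure state needs an auxiliary system of at most the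
-- dimension of the queried one.
theorem eaMaxFidelity_one_le (Φ₀ Φ₁ : SuperOp ι κ) {ψ : EuclideanSpace ℂ (R × ι)} (hψ : ‖ψ‖ = 1) :
    eaMaxFidelity 1 Φ₀ Φ₁ ≤
      maxFidelity (idTensor R Φ₀ (pureState ψ)) (idTensor R Φ₁ (pureState ψ)) := by
  obtain ⟨V, hV⟩ := exists_toEuclideanLin_kronecker_one_eq ψ
  let W (μ : Type) [DecidableEq μ] : Matrix (ι × μ) (R × μ) ℂ := Vᴴ ⊗ₖ (1 : Matrix μ μ ℂ)
  have conjTranspose_mul_self (μ : Type) [Fintype μ] [DecidableEq μ] :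
      (W μ)ᴴ * W μ = (V * Vᴴ) ⊗ₖ (1 : Matrix μ μ ℂ) := by
    rw [Matrix.conjTranspose_kronecker, ← Matrix.mul_kronecker_mul,
      Matrix.conjTranspose_conjTranspose, Matrix.conjTranspose_one, Matrix.one_mul]
  have idTensor_compress (Φ : SuperOp ι κ) : idTensor ι Φ (pureState (toEuclideanLin (W ι) ψ)) =
      W κ * idTensor R Φ (pureState ψ) * (W κ)ᴴ := by
    simpa only [← mul_pureState_mul_conjTranspose, W, Matrix.conjTranspose_kronecker,
      Matrix.conjTranspose_one] using idTensor_mul_mul_kronecker_one Φ Vᴴ (pureState ψ) Vᴴᴴ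
  have pureState_fixed : ((V * Vᴴ) ⊗ₖ (1 : Matrix ι ι ℂ)) * pureState ψ = pureState ψ := by
    rw [pureState_eq_vecMulVec, Matrix.mul_vecMulVec]
    exact congrArg (Matrix.vecMulVec · _) (congrArg WithLp.ofLp hV)
  have idTensor_fixed (Φ : SuperOp ι κ) :
      (W κ)ᴴ * W κ * idTensor R Φ (pureState ψ) = idTensor R Φ (pureState ψ) := by
    have h := idTensor_mul_mul_kronecker_one Φ (V * Vᴴ) (pureState ψ) 1
    rwa [Matrix.one_kronecker_one, Matrix.one_kronecker_one, Matrix.mul_one, Matrix.mul_one,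
      pureState_fixed, ← conjTranspose_mul_self, eq_comm] at h
  have norm_compress : ‖toEuclideanLin (W ι) ψ‖ = 1 := by
    rw [norm_toEuclideanLin_of_fixed (by rw [conjTranspose_mul_self, hV]), hψ]
  calc eaMaxFidelity 1 Φ₀ Φ₁
      ≤ maxFidelity (W κ * idTensor R Φ₀ (pureState ψ) * (W κ)ᴴ)
          (W κ * idTensor R Φ₁ (pureState ψ) * (W κ)ᴴ) := by
        rw [← idTensor_compress, ← idTensor_compress]
        exact qMaxFidelity_one_le _ _ norm_compress
    _ ≤ _ := maxFidelity_mul_mul_conjTranspose_le (idTensor_fixed Φ₀) (idTensor_fixed Φ₁)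

end AuxiliaryReduction

section Queries

variable {ι R : Type} [Fintype ι] [DecidableEq ι] [Fintype R] [DecidableEq R]

theorem eaMaxFidelity_one_conjOp_comp_le (E : SuperOp ι ι) {U : Matrix ι ι ℂ}
    (hU : U ∈ Matrix.unitaryGroup ι ℂ) {ψ : EuclideanSpace ℂ (R × ι)} (hψ : ‖ψ‖ = 1) :
    eaMaxFidelity 1 (conjOp Uᴴ ∘ₗ E) LinearMap.id ≤
      maxFidelity (idTensor R E (pureState ψ)) (idTensor R (conjOp U) (pureState ψ)) := by
  let A : Matrix (R × ι) (R × ι) ℂ := 1 ⊗ₖ U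
  have hA : A ∈ Matrix.unitaryGroup (R × ι) ℂ := Matrix.kronecker_mem_unitary (one_mem _) hU
  have hA₁ : Aᴴ * A = 1 := Matrix.mem_unitaryGroup_iff'.1 hA
  have hA₂ : Aᴴᴴ * Aᴴ = 1 := by simpa using! Matrix.mem_unitaryGroup_iff.1 hA
  have compress_E : idTensor R (conjOp Uᴴ ∘ₗ E) (pureState ψ) =
      Aᴴ * idTensor R E (pureState ψ) * Aᴴᴴ := by
    rw [Matrix.conjTranspose_kronecker, Matrix.conjTranspose_one]
    exact idTensor_conjOp Uᴴ (idTensor R E (pureState ψ))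
  have compress_U : pureState ψ = Aᴴ * idTensor R (conjOp U) (pureState ψ) * Aᴴᴴ := by
    rw [idTensor_conjOp_pureState, mul_pureState_mul_conjTranspose,
      ← toEuclideanLin_mul_apply, hA₁, toEuclideanLin_one_apply]
  calc eaMaxFidelity 1 (conjOp Uᴴ ∘ₗ E) LinearMap.id
      ≤ maxFidelity (idTensor R (conjOp Uᴴ ∘ₗ E) (pureState ψ)) (pureState ψ) :=
        eaMaxFidelity_one_le (R := R) (conjOp Uᴴ ∘ₗ E) LinearMap.id hψ
    _ = maxFidelity (Aᴴ * idTensor R E (pureState ψ) * Aᴴᴴ)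
          (Aᴴ * idTensor R (conjOp U) (pureState ψ) * Aᴴᴴ) := by rw [compress_E, ← compress_U]
    _ ≤ _ := maxFidelity_mul_mul_conjTranspose_le (by rw [hA₂, Matrix.one_mul])
        (by rw [hA₂, Matrix.one_mul])

theorem arccos_maxFidelity_query_le {E : SuperOp ι ι} (hE : IsQuantumOperation E)
    {U : Matrix ι ι ℂ} (hU : U ∈ Matrix.unitaryGroup ι ℂ)
    {ρ₀ ρ₁ : Matrix (R × ι) (R × ι) ℂ} (h₀ : IsDensity ρ₀) (h₁ : IsDensity ρ₁) :
    Real.arccos (maxFidelity (idTensor R E ρ₀) (idTensor R (conjOp U) ρ₁)) ≤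
      Real.arccos (eaMaxFidelity 1 (conjOp Uᴴ ∘ₗ E) LinearMap.id) +
        Real.arccos (maxFidelity ρ₀ ρ₁) := by
  let A : Matrix (R × ι) (R × ι) ℂ := 1 ⊗ₖ U
  have hA : toEuclideanLin (Aᴴ * A) = LinearMap.id := by
    have hA : Aᴴ * A = 1 :=
      Matrix.mem_unitaryGroup_iff'.1 (Matrix.kronecker_mem_unitary (one_mem _) hU)
    exact LinearMap.ext fun x => by rw [hA, toEuclideanLin_one_apply, LinearMap.id_apply]
  have norm_A (x) : ‖toEuclideanLin A x‖ = ‖x‖ :=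
    norm_toEuclideanLin_of_fixed (LinearMap.congr_fun hA x)
  obtain ⟨φ₀, hφ₀, φ₁, hφ₁, n₀, n₁, hφ⟩ := exists_norm_inner_eq_maxFidelity h₀.ne_zero h₁.ne_zero
  have nA₀ : ‖toEuclideanLin A φ₀‖ = 1 := by rw [norm_A, n₀]
  have nA₁ : ‖toEuclideanLin A φ₁‖ = 1 := by rw [norm_A, n₁]
  obtain ⟨χ, hχ, nχ, hχφ⟩ := exists_norm_inner_eq_maxFidelity_pureState
    ((hE.idTensor (R := R)).isDensity (isDensity_pureState n₀)).ne_zero nA₀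
  have χ_mem : χ ∈ supp (idTensor R E ρ₀) := by
    refine hE.idTensor.supp_mono (isDensity_pureState n₀).1 h₀.1 ?_ hχ
    rwa [supp_pureState, Submodule.span_singleton_le_iff_mem]
  have Aφ₁_mem : toEuclideanLin A φ₁ ∈ supp (idTensor R (conjOp U) ρ₁) := by
    rw [idTensor_conjOp, conjOp_apply, supp_mul_mul_conjTranspose _ h₁.1]
    exact Submodule.mem_map_of_mem hφ₁
  calc Real.arccos (maxFidelity (idTensor R E ρ₀) (idTensor R (conjOp U) ρ₁))
      ≤ Real.arccos ‖inner ℂ χ (toEuclideanLin A φ₁)‖ :=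
        Real.antitone_arccos (norm_inner_le_maxFidelity χ_mem Aφ₁_mem nχ nA₁)
    _ ≤ Real.arccos ‖inner ℂ χ (toEuclideanLin A φ₀)‖ +
          Real.arccos ‖inner ℂ (toEuclideanLin A φ₀) (toEuclideanLin A φ₁)‖ :=
        arccos_norm_inner_le_add nχ nA₀ nA₁
    _ ≤ _ := by
        rw [hχφ, inner_toEuclideanLin_toEuclideanLin_of_fixed (LinearMap.congr_fun hA φ₁), hφ,
          ← idTensor_conjOp_pureState]
        gcongr
        exact eaMaxFidelity_one_conjOp_comp_le E hU n₀

theorem Scheme.isDensity_state (S : Scheme ι) {X : SuperOp ι ι} (hX : IsQuantumOperation X) :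
    ∀ n, IsDensity (S.state X n)
  | 0 => S.init_isDensity
  | n + 1 =>
    (S.op_isQuantumOperation n).isDensity (hX.idTensor.isDensity (S.isDensity_state hX n))

theorem Scheme.arccos_maxFidelity_state_le (S : Scheme ι) {E : SuperOp ι ι}
    (hE : IsQuantumOperation E) {U : Matrix ι ι ℂ} (hU : U ∈ Matrix.unitaryGroup ι ℂ) (n : ℕ) :
    Real.arccos (maxFidelity (S.state E n) (S.state (conjOp U) n)) ≤
      n * Real.arccos (eaMaxFidelity 1 (conjOp Uᴴ ∘ₗ E) LinearMap.id) := by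
  have hU' := isQuantumOperation_conjOp hU
  induction n with
  | zero =>
    rw [Nat.cast_zero, zero_mul]
    exact (Real.arccos_eq_zero.2 (one_le_maxFidelity_self S.init_isDensity.ne_zero)).le
  | succ n ih =>
    have d₀ := S.isDensity_state hE n
    have d₁ := S.isDensity_state hU' n
    calc Real.arccos (maxFidelity (S.state E (n + 1)) (S.state (conjOp U) (n + 1)))
        ≤ Real.arccos (maxFidelity (idTensor _ E (S.state E n))
            (idTensor _ (conjOp U) (S.state (conjOp U) n))) :=
          Real.antitone_arccos ((S.op_isQuantumOperation n).maxFidelity_le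
            (hE.idTensor.isDensity d₀).1 (hU'.idTensor.isDensity d₁).1)
      _ ≤ _ := arccos_maxFidelity_query_le hE hU d₀ d₁
      _ ≤ _ := by
          push_cast
          linarith

theorem DistinguishableIn.pi_div_two_le {E : SuperOp ι ι} (hE : IsQuantumOperation E)
    {U : Matrix ι ι ℂ} (hU : U ∈ Matrix.unitaryGroup ι ℂ) {n : ℕ}
    (h : DistinguishableIn n (conjOp U) E) :
    Real.pi / 2 ≤ n * Real.arccos (eaMaxFidelity 1 (conjOp Uᴴ ∘ₗ E) LinearMap.id) := by
  obtain ⟨S, hS⟩ := h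
  rw [← Real.arccos_zero, ← hS.symm.maxFidelity_eq_zero (S.isDensity_state hE n)
    (S.isDensity_state (isQuantumOperation_conjOp hU) n)]
  exact S.arccos_maxFidelity_state_le hE hU n

end Queries

end QDisc

theorem mainTheorem5_general {ι : Type} [Fintype ι] [DecidableEq ι] (U : Matrix ι ι ℂ)
    (hU : U ∈ Matrix.unitaryGroup ι ℂ)
    (E : QDisc.SuperOp ι ι) (hE : QDisc.IsQuantumOperation E)
    (hdist : QDisc.PerfectlyDistinguishable (QDisc.conjOp U) E) :
    QDisc.eaMaxFidelity 1 (QDisc.conjOp Uᴴ ∘ₗ E) LinearMap.id < 1 ∧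
    ⌈Real.pi / (2 * Real.arccos
        (QDisc.eaMaxFidelity 1 (QDisc.conjOp Uᴴ ∘ₗ E) LinearMap.id))⌉₊ ≤
      QDisc.minQueries (QDisc.conjOp U) E := by
  set α := Real.arccos (QDisc.eaMaxFidelity 1 (QDisc.conjOp Uᴴ ∘ₗ E) LinearMap.id)
  have optimal : QDisc.DistinguishableIn (QDisc.minQueries (QDisc.conjOp U) E) (QDisc.conjOp U) E :=
    Nat.sInf_mem hdist
  have pi_div_two_le : Real.pi / 2 ≤ QDisc.minQueries (QDisc.conjOp U) E * α :=
    optimal.pi_div_two_le hE hU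
  have α_pos : 0 < α :=
    pos_of_mul_pos_right (Real.pi_div_two_pos.trans_le pi_div_two_le) (Nat.cast_nonneg _)
  refine ⟨Real.arccos_pos.1 α_pos, Nat.ceil_le.2 ?_⟩
  rw [div_le_iff₀ (by positivity)]
  linarith

theorem mainTheorem5 {d : ℕ} (U : Matrix (Fin d) (Fin d) ℂ)
    (hU : U ∈ Matrix.unitaryGroup (Fin d) ℂ)
    (E : QDisc.SuperOp (Fin d) (Fin d)) (hE : QDisc.IsQuantumOperation E)
    (hdist : QDisc.PerfectlyDistinguishable (QDisc.conjOp U) E) :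
    QDisc.eaMaxFidelity 1 (QDisc.conjOp Uᴴ ∘ₗ E) LinearMap.id < 1 ∧
    ⌈Real.pi / (2 * Real.arccos
        (QDisc.eaMaxFidelity 1 (QDisc.conjOp Uᴴ ∘ₗ E) LinearMap.id))⌉₊ ≤
      QDisc.minQueries (QDisc.conjOp U) E :=
  mainTheorem5_general U hU E hE hdist
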